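/- Let $n \ge 1$ and $m \ge 0$ be integers, let $Q, r, X_1,\dots,X_n$ be elements of a field $K$ (for example, algebraically independent indeterminates, with $K$ the field of rational functions in them over $\mathbb{Q}$) such that $Q \neq 0$, $X_i \neq 0$ and $Q+X_i \neq 0$ for all $i$, $Q - X_iX_j \ne 0$ for all $i \le j$, and $X_i \neq X_j$ for all $i<j$. For a function $f$ of $n$ variables, let $$\mathbf{ASym}_{X_1,\dots,X_n} f(X_1,\dots,X_n) = \sum_{\sigma\in \mathcal S_n} \operatorname{sgn}\sigma \cdot f(X_{\sigma(1)},\dots,X_{\sigma(n)}).$$ Then $$\frac{1}{\prod_{1\le i<j\le n}(X_j-X_i)}\, \mathbf{ASym}_{X_1,\dots,X_n}\left[\prod_{1\le i<j\le n}\bigl(Q+(Q+r)X_i+X_j+X_iX_j\bigr) \sum_{0\le k_1<k_2<\dots<k_n\le m}\ \prod_{i=1}^n\left(\frac{X_i(1+X_i)}{Q+X_i}\right)^{k_i}\right] = \frac{\det_{1\le i,j\le n}\bigl(a_{j,m,n}(Q,r;X_i)\bigr)}{\prod_{1\le i\le j\le n}(Q-X_iX_j)\ \prod_{1\le i<j\le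 n}(X_j-X_i)},$$ where $$a_{j,m,n}(Q,r;X) = (1+QX^{-1})X^j(1+X)^{j-1}(Q+rX+QX)^{n-j} - X^{2n}Q^{-n}\left(\frac{(1+X)X}{Q+X}\right)^m(1+X)(QX^{-1})^j(1+QX^{-1})^{j-1}(Q+rQX^{-1}+Q^2X^{-1})^{n-j}.$$ -/

import Mathlib

open scoped BigOperators

/-- The antisymmetrizer, evaluated at the tuple `X`:
`∑_σ sgn σ · f (X_{σ(1)}, …, X_{σ(n)})`. -/
def ASym {K : Type*} [Field K] {n : ℕ} (f : (Fin n → K) → K) (X : Fin n → K) : K :=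
  ∑ σ : Equiv.Perm (Fin n), ((Equiv.Perm.sign σ : ℤ) : K) * f (fun i => X (σ i))

/-- `∏_{i<j} (X_j - X_i)`. -/
def vandermondeProd {K : Type*} [Field K] {n : ℕ} (X : Fin n → K) : K :=
  ∏ i, ∏ j ∈ Finset.Ioi i, (X j - X i)

/-- `∏_{i<j} (Q + (Q+r) X_i + X_j + X_i X_j)`. -/
def kernelProd {K : Type*} [Field K] {n : ℕ} (Q r : K) (X : Fin n → K) : K :=
  ∏ i, ∏ j ∈ Finset.Ioi i, (Q + (Q + r) * X i + X j + X i * X j)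

/-- `∑_{0 ≤ k_1 < ⋯ < k_n ≤ m} ∏_i (X_i (1 + X_i) / (Q + X_i)) ^ k_i`. -/
def boundedSum {K : Type*} [Field K] {n : ℕ} (m : ℕ) (Q : K) (X : Fin n → K) : K :=
  ∑ k ∈ (Finset.univ : Finset (Fin n → Fin (m + 1))).filter
      (fun k => ∀ i j, i < j → k i < k j),
    ∏ i, (X i * (1 + X i) / (Q + X i)) ^ (k i : ℕ)

/-- The entries `a_{j,m,n}(Q,r;x)`, for `1 ≤ j ≤ n`. -/
def aEntry {K : Type*} [Field K] (j m n : ℕ) (Q r x : K) : K :=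
  (1 + Q * x⁻¹) * x ^ j * (1 + x) ^ (j - 1) * (Q + r * x + Q * x) ^ (n - j)
    - x ^ (2 * n) * (Q ^ n)⁻¹ * ((1 + x) * x / (Q + x)) ^ m * (1 + x)
      * (Q * x⁻¹) ^ j * (1 + Q * x⁻¹) ^ (j - 1)
      * (Q + r * Q * x⁻¹ + Q ^ 2 * x⁻¹) ^ (n - j)

/-!
The identity is a disguised form of a polynomial identity in `2n` free variables `b i`, `w i`,
```
(∑ σ, sgn σ * ∏_{i<j} (b (σ j) - w (σ i) * b (σ i)) * ∑_{0 ≤ k₁ < ⋯ < kₙ < M} ∏ i, w (σ i) ^ k i)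
  * ∏ i, (1 - w i)  =  det (b i ^ j * (w i ^ j - w i ^ M)),    0 ≤ j < n,
```
which is `alternating_sum_mul_prod_eq_det`. To see this, put `u = X (1 + X)`, `v = Q + (Q + r) X`,
`g = Q + X`, `h = X (X + Q + r)`, `w = u / g`. The whole proof rests on `u + v = g + h`; call this
common value `e`. For two values `x`, `y` of `X` one has
```
(Q + (Q + r) y + x + x y) (Q - x y) = e(y) g(x) - e(x) u(y),      Q - x² = g(x) (1 - w(x)),
```
so with `b = g / e` the symmetric factors `Q - Xᵢ Xⱼ` turn the given kernel into the kernel above.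
On the other side the entries are `g (u ^ j v ^ (n-1-j) - w ^ (m+1) g ^ j h ^ (n-1-j))`
(`aEntry_succ`), with `v = e - u` and `h = e - g`; as the `z ^ j (1 - z) ^ (n-1-j)` are a
unitriangular transform of the monomials, the determinant reduces to the one above
(`det_bernstein_sub_eq_det_pow_sub`). Zeros of `e` are avoided by replacing `e` by `e + t` with an
indeterminate `t` and setting `t = 0` afterwards (`altSide_eq_detSide`).

The core identity is proved by induction on `M`. Splitting off the terms with `kₙ = M` and expanding
over `σ n` gives a recursion for the left-hand side. The determinants satisfy the same recursion
(`det_pow_sub_recursion`): with `a = w b`, `P = ∏ (z - aₗ)` and `C = (P - P(0)) / z`, which is monic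
of degree `n - 1`, the coefficient of the `i`-th minor, `(1 - wᵢ) ∏_{l ≠ i} (bᵢ - aₗ)`, is a
combination of `C(bᵢ)` and `C(aᵢ)`, and this allows the sum of minors to be recognized as a
difference of two Laplace expansions.
-/

open Equiv

section CommRing

variable {R : Type*} [CommRing R]

/-! ### Expansion of alternating sums over permutations -/

/-- Expansion of an alternating sum over the permutations of `Fin (n + 1)` along the image `p` of
`0`; the summand sees the permutation as a map, with values `p, p.succAbove ∘ e`. -/
theorem sum_sign_mul_eq_sum_cons {n : ℕ} (F : (Fin (n + 1) → Fin (n + 1)) → R) :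
    ∑ σ : Perm (Fin (n + 1)), ((Perm.sign σ : ℤ) : R) * F σ =
      ∑ p : Fin (n + 1), (-1) ^ (p : ℕ) *
        ∑ e : Perm (Fin n), ((Perm.sign e : ℤ) : R) * F (Fin.cons p (p.succAbove ∘ e)) := by
  rw [Finset.univ_perm_fin_succ, ← Finset.univ_product_univ]
  simp only [Finset.sum_map, Equiv.toEmbedding_apply, Finset.sum_product]
  refine Finset.sum_congr rfl fun p _ => ?_
  rw [Finset.mul_sum]
  induction p using Fin.cases with
  | zero =>
    refine Finset.sum_congr rfl fun e _ => ?_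
    have : ((Perm.decomposeFin.symm (0, e) : Perm (Fin (n + 1))) : Fin (n + 1) → Fin (n + 1))
        = Fin.cons 0 ((0 : Fin (n + 1)).succAbove ∘ e) := by
      ext i
      induction i using Fin.cases <;> simp
    rw [this]
    simp [Perm.decomposeFin.symm_sign]
  | succ i =>
    refine Fintype.sum_equiv (Equiv.mulLeft i.cycleRange) _ _ fun e => ?_
    have : ((Perm.decomposeFin.symm (i.succ, e) : Perm (Fin (n + 1))) : Fin (n + 1) → Fin (n + 1))
        = Fin.cons i.succ (i.succ.succAbove ∘ (i.cycleRange * e)) := by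
      ext j
      induction j using Fin.cases <;> simp [Fin.succAbove_cycleRange]
    simp only [Equiv.coe_mulLeft, this, Perm.sign_mul, Perm.decomposeFin.symm_sign,
      if_neg (Fin.succ_ne_zero i), Fin.sign_cycleRange, Perm.coe_mul]
    generalize F (Fin.cons i.succ (i.succ.succAbove ∘ i.cycleRange ∘ e)) = z
    simp only [Fin.val_succ, pow_succ]
    push_cast
    have h : ((-1 : R) ^ (i : ℕ)) * (-1) ^ (i : ℕ) = 1 := by
      rw [← mul_pow]; simp
    linear_combination (((Perm.sign e : ℤ) : R) * z) * h

/-- Expansion of an alternating sum along the image of the last element. -/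
theorem sum_sign_mul_eq_sum_snoc {n : ℕ} (F : (Fin (n + 1) → Fin (n + 1)) → R) :
    ∑ σ : Perm (Fin (n + 1)), ((Perm.sign σ : ℤ) : R) * F σ =
      ∑ p : Fin (n + 1), (-1) ^ ((p : ℕ) + n) *
        ∑ e : Perm (Fin n), ((Perm.sign e : ℤ) : R) * F (Fin.snoc (p.succAbove ∘ e) p) := by
  have h := sum_sign_mul_eq_sum_cons (fun f => F (f ∘ finRotate (n + 1)))
  have h2 : ∑ σ : Perm (Fin (n + 1)), ((Perm.sign σ : ℤ) : R) * F σ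
      = (-1) ^ n * ∑ σ : Perm (Fin (n + 1)), ((Perm.sign σ : ℤ) : R) *
          F (σ ∘ finRotate (n + 1)) := by
    rw [Finset.mul_sum]
    symm
    refine Fintype.sum_equiv (Equiv.mulRight (finRotate (n + 1))) _ _ fun e => ?_
    rw [Equiv.coe_mulRight, Perm.sign_mul, sign_finRotate, Perm.coe_mul]
    simp only [Nat.add_sub_cancel]
    push_cast
    ring
  rw [h2, h, Finset.mul_sum]
  refine Finset.sum_congr rfl fun p _ => ?_
  have key (e : Perm (Fin n)) : (Fin.cons p (p.succAbove ∘ e) : Fin (n + 1) → Fin (n + 1)) ∘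
      finRotate (n + 1) = Fin.snoc (α := fun _ => Fin (n + 1)) (p.succAbove ∘ e) p := by
    ext j
    induction j using Fin.lastCases with
    | last => simp
    | cast j => simp [Fin.snoc_castSucc]
  simp only [key]
  ring

/-! ### Sums over strictly increasing exponents -/

/-- The sum of `∏ i, w i ^ k i` over all strictly increasing `k : Fin n → {0, …, M - 1}`. -/
def strictSum (M n : ℕ) (w : Fin n → R) : R :=
  ∑ k ∈ (Fintype.piFinset fun _ : Fin n => Finset.range M).filter StrictMono, ∏ i, w i ^ k i

theorem strictSum_zero_right (M : ℕ) (w : Fin 0 → R) : strictSum M 0 w = 1 := by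
  simp [strictSum, Finset.filter_true_of_mem, Subsingleton.strictMono]

theorem strictSum_zero_left (n : ℕ) (w : Fin (n + 1) → R) : strictSum 0 (n + 1) w = 0 := by
  simp [strictSum]

/-- Splitting off the exponent of the last variable when it has its largest possible value. -/
theorem strictSum_succ (M n : ℕ) (w : Fin (n + 1) → R) :
    strictSum (M + 1) (n + 1) w =
      strictSum M (n + 1) w + w (Fin.last n) ^ M * strictSum M n (w ∘ Fin.castSucc) := by
  unfold strictSum
  rw [← Finset.sum_filter_not_add_sum_filter _ (fun k => k (Fin.last n) = M)]
  congr 1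
  · refine Finset.sum_congr ?_ fun _ _ => rfl
    ext k
    simp only [Finset.mem_filter, Fintype.mem_piFinset, Finset.mem_range]
    constructor
    · rintro ⟨⟨h1, h2⟩, h3⟩
      refine ⟨fun i => ?_, h2⟩
      have := h2.monotone (Fin.le_last i)
      have := h1 (Fin.last n)
      omega
    · rintro ⟨h1, h2⟩
      exact ⟨⟨fun i => (h1 i).trans (Nat.lt_succ_self M), h2⟩, (h1 _).ne⟩
  · rw [Finset.mul_sum]
    refine Finset.sum_bij' (fun k _ => Fin.init k) (fun k _ => Fin.snoc k M) ?_ ?_ ?_ ?_ ?_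
    · intro k hk
      simp only [Finset.mem_filter, Fintype.mem_piFinset, Finset.mem_range] at hk ⊢
      obtain ⟨⟨h1, h2⟩, h3⟩ := hk
      refine ⟨fun i => ?_, fun i j hij => h2 (Fin.castSucc_lt_castSucc_iff.2 hij)⟩
      rw [← h3]
      exact h2 (Fin.castSucc_lt_last i)
    · intro k hk
      simp only [Finset.mem_filter, Fintype.mem_piFinset, Finset.mem_range] at hk ⊢
      obtain ⟨h1, h2⟩ := hk
      refine ⟨⟨fun i => ?_, fun i j hij => ?_⟩, by simp⟩
      · induction i using Fin.lastCases with
        | last => simp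
        | cast i => simpa using (h1 i).trans (Nat.lt_succ_self M)
      · induction j using Fin.lastCases with
        | last =>
          induction i using Fin.lastCases with
          | last => exact absurd hij (lt_irrefl _)
          | cast i => simpa using h1 i
        | cast j =>
          induction i using Fin.lastCases with
          | last => exact absurd hij (Fin.castSucc_lt_last j).not_gt
          | cast i => simpa using h2 (Fin.castSucc_lt_castSucc_iff.1 hij)
    · intro k hk
      simp only [Finset.mem_filter] at hk
      rw [← hk.2, Fin.snoc_init_self]
    · intro k hk
      simp
    · intro k hk
      simp only [Finset.mem_filter] at hk
      rw [Fin.prod_univ_castSucc, hk.2, mul_comm]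
      rfl

/-! ### The core identity -/

open Polynomial in
/-- The coefficients `c` are those of `P.divX`, where `P = ∏ l, (X - a l)`. The left-hand side is
`y` times the coefficient of the `i`-th minor in `det_pow_sub_recursion`. In the sum on the right,
the terms with `k < n` are combinations of the other columns of the Laplace expansion there, so
that only the last term, with coefficient `1`, matters. -/
theorem mul_prod_sub_succAbove_eq_sub_sum {n : ℕ} (a b w : Fin (n + 1) → R) (ha : ∀ i, a i = w i * b i) :
    ∃ c : Fin (n + 1) → R, c (Fin.last n) = 1 ∧ ∀ (y : R) (i : Fin (n + 1)),
      y * ((1 - w i) * ∏ l : Fin n, (b i - a (i.succAbove l))) =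
        (-1) ^ n * ((1 - w i * y) * ∏ l : Fin n, a (i.succAbove l)) -
          ∑ k : Fin (n + 1), c k * (a i ^ (k : ℕ) - y * b i ^ (k : ℕ)) := by
  let P : R[X] := ∏ l, (X - C (a l))
  have hPm : P.Monic := monic_prod_X_sub_C a Finset.univ
  by_cases hR : Subsingleton R
  · exact ⟨fun _ => 1, rfl, fun _ _ => Subsingleton.elim _ _⟩
  rw [not_subsingleton_iff_nontrivial] at hR
  have hPd : P.natDegree = n + 1 := by
    simp [P]
  have hev (z : R) : P.divX.eval z = ∑ k : Fin (n + 1), P.coeff (k + 1) * z ^ (k : ℕ) := by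
    rw [eval_eq_sum_range' (n := n + 1), Finset.sum_range]
    · simp [coeff_divX]
    · rw [natDegree_divX_eq_natDegree_tsub_one, hPd]; simp
  refine ⟨fun k => P.coeff (k + 1), ?_, fun y i => ?_⟩
  · have := hPm.coeff_natDegree
    simpa [hPd] using this
  -- `E` is the cofactor of `X - a i` in `P`; then `P.divX = E - a i * E.divX`.
  let E : R[X] := ∏ l : Fin n, (X - C (a (i.succAbove l)))
  have hPE : P = (X - C (a i)) * E := Fin.prod_univ_succAbove _ i
  have hE : E.divX * X + C (E.coeff 0) = E := divX_mul_X_add E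
  have hD : P.divX = E - C (a i) * E.divX := by
    ext k
    simp [coeff_divX, hPE, sub_mul, coeff_X_mul]
  have hEz (z : R) : E.eval z = ∏ l : Fin n, (z - a (i.succAbove l)) := by
    simp [E, eval_prod]
  have hE0 : E.coeff 0 = (-1) ^ n * ∏ l : Fin n, a (i.succAbove l) := by
    rw [coeff_zero_eq_eval_zero, hEz]
    simp [Finset.prod_neg]
  have e1 := congrArg (eval (b i)) hE
  have e2 := congrArg (eval (a i)) hE
  have d1 := congrArg (eval (b i)) hD
  have d2 := congrArg (eval (a i)) hD
  simp only [eval_add, eval_sub, eval_mul, eval_X, eval_C] at e1 e2 d1 d2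
  rw [hE0] at e1 e2
  have hs : ∑ k : Fin (n + 1), P.coeff (k + 1) * (a i ^ (k : ℕ) - y * b i ^ (k : ℕ)) =
      P.divX.eval (a i) - y * P.divX.eval (b i) := by
    rw [hev, hev, Finset.mul_sum, ← Finset.sum_sub_distrib]
    exact Finset.sum_congr rfl fun k _ => by ring
  rw [hs, ← hEz, d1, d2, ha]
  rw [ha] at e2
  linear_combination (y * w i) * e1 - e2

open Matrix in
/-- The determinants on the right-hand side of the core identity satisfy a recursion of the same
shape as the alternating sums on its left-hand side; the role of `y i` is played by `w i ^ M`,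
so that `w i * y i` corresponds to raising `M` by one. -/
theorem det_pow_sub_recursion {n : ℕ} (b w y : Fin (n + 1) → R) :
    (of fun i j : Fin (n + 1) => b i ^ (j : ℕ) * (w i ^ (j : ℕ) - w i * y i)).det -
      (of fun i j : Fin (n + 1) => b i ^ (j : ℕ) * (w i ^ (j : ℕ) - y i)).det =
    ∑ p : Fin (n + 1), (-1) ^ ((p : ℕ) + n) *
      (y p * ((1 - w p) * ∏ l : Fin n, (b p - w (p.succAbove l) * b (p.succAbove l))) *
      (of fun i j : Fin n => b (p.succAbove i) ^ (j : ℕ) *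
        (w (p.succAbove i) ^ (j : ℕ) - y (p.succAbove i))).det) := by
  obtain ⟨c, hc, h⟩ := mul_prod_sub_succAbove_eq_sub_sum (fun i => w i * b i) b w fun _ => rfl
  set A : Matrix (Fin (n + 1)) (Fin (n + 1)) R :=
    of fun i j : Fin (n + 1) => b i ^ (j : ℕ) * (w i ^ (j : ℕ) - y i) with hA
  have h1 : A.det = ∑ p : Fin (n + 1), (-1) ^ ((p : ℕ) + n) *
      (∑ k, c k * A p k) * (of fun i j : Fin n => b (p.succAbove i) ^ (j : ℕ) *
        (w (p.succAbove i) ^ (j : ℕ) - y (p.succAbove i))).det := by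
    -- Adding multiples of the other columns to the last one preserves the determinant.
    have := det_updateCol_sum A (Fin.last n) c
    rw [hc, one_smul] at this
    rw [← this, det_succ_column _ (Fin.last n)]
    refine Finset.sum_congr rfl fun p _ => ?_
    congr 2
    · simp
    · ext i j
      simp [hA]
  have h2 : (of fun i j : Fin (n + 1) => b i ^ (j : ℕ) * (w i ^ (j : ℕ) - w i * y i)).det =
      ∑ p : Fin (n + 1), (-1) ^ (p : ℕ) * (1 - w p * y p) *
        ((∏ l : Fin n, w (p.succAbove l) * b (p.succAbove l)) *
        (of fun i j : Fin n => b (p.succAbove i) ^ (j : ℕ) *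
        (w (p.succAbove i) ^ (j : ℕ) - y (p.succAbove i))).det) := by
    rw [det_succ_column_zero]
    refine Finset.sum_congr rfl fun p _ => ?_
    rw [← det_mul_column]
    congr 2
    · simp
    · ext i j
      simp only [submatrix_apply, of_apply, Fin.val_succ]
      ring
  rw [h1, h2, ← Finset.sum_sub_distrib]
  refine Finset.sum_congr rfl fun p _ => ?_
  have hp : ∑ k, c k * A p k =
      ∑ k : Fin (n + 1), c k * ((w p * b p) ^ (k : ℕ) - y p * b p ^ (k : ℕ)) :=
    Finset.sum_congr rfl fun k _ => by rw [hA, of_apply]; ring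
  rw [hp, h (y p) p, pow_add]
  have hs : ((-1 : R) ^ n) * (-1) ^ n = 1 := by
    rw [← mul_pow]; simp
  generalize (∏ l : Fin n, w (p.succAbove l) * b (p.succAbove l)) = z1
  generalize (of fun i j : Fin n => b (p.succAbove i) ^ (j : ℕ) *
    (w (p.succAbove i) ^ (j : ℕ) - y (p.succAbove i))).det = z2
  linear_combination (-(-1) ^ (p : ℕ) * (1 - w p * y p) * z1 * z2) * hs

open Matrix in
/-- The core identity, valid for arbitrary `b` and `w` in a commutative ring. Both sides vanish at
`M = 0` (unless `n = 0`), and they change in the same way when `M` is raised by one. -/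
theorem alternating_sum_mul_prod_eq_det (M n : ℕ) (b w : Fin n → R) :
    (∑ σ : Perm (Fin n), ((Perm.sign σ : ℤ) : R) *
      ((∏ i, ∏ j ∈ Finset.Ioi i, (b (σ j) - w (σ i) * b (σ i))) * strictSum M n (w ∘ σ))) *
        ∏ i, (1 - w i) =
      (of fun i j : Fin n => b i ^ (j : ℕ) * (w i ^ (j : ℕ) - w i ^ M)).det := by
  induction M generalizing n with
  | zero =>
    cases n with
    | zero => simp [strictSum_zero_right]
    | succ n =>
      rw [det_eq_zero_of_column_eq_zero 0 (by simp)]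
      simp [strictSum_zero_left]
  | succ M ih =>
    cases n with
    | zero => simp [strictSum_zero_right]
    | succ n =>
      have hrec := det_pow_sub_recursion b w fun i => w i ^ M
      simp only [← pow_succ'] at hrec
      rw [sub_eq_iff_eq_add'] at hrec
      simp only [← ih] at hrec
      rw [hrec]
      simp only [strictSum_succ, mul_add, Finset.sum_add_distrib, add_mul]
      congr 1
      have hexp := sum_sign_mul_eq_sum_snoc fun f : Fin (n + 1) → Fin (n + 1) =>
        (∏ i, ∏ j ∈ Finset.Ioi i, (b (f j) - w (f i) * b (f i))) *
          (w (f (Fin.last n)) ^ M * strictSum M n (w ∘ f ∘ Fin.castSucc))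
      simp only [Function.comp_assoc, Function.comp_apply] at hexp ⊢
      rw [hexp, Finset.sum_mul]
      refine Finset.sum_congr rfl fun p _ => ?_
      -- The last factor of the kernel does not depend on the order of the other variables.
      have hker (e : Perm (Fin n)) :
          ∏ i, ∏ j ∈ Finset.Ioi i,
            (b (Fin.snoc (α := fun _ => Fin (n + 1)) (p.succAbove ∘ e) p j) -
              w (Fin.snoc (α := fun _ => Fin (n + 1)) (p.succAbove ∘ e) p i) *
              b (Fin.snoc (α := fun _ => Fin (n + 1)) (p.succAbove ∘ e) p i)) =
          (∏ l : Fin n, (b p - w (p.succAbove l) * b (p.succAbove l))) *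
          ∏ i, ∏ j ∈ Finset.Ioi i, (b (p.succAbove (e j)) -
            w (p.succAbove (e i)) * b (p.succAbove (e i))) := by
        rw [Fin.prod_univ_castSucc, 
          ← Equiv.prod_comp e fun l => b p - w (p.succAbove l) * b (p.succAbove l), ← Finset.prod_mul_distrib]
        have : Finset.Ioi (Fin.last n) = ∅ := by
          ext i; simp [Fin.le_last]
        rw [this, Finset.prod_empty, mul_one]
        refine Finset.prod_congr rfl fun i _ => ?_
        have : Finset.Ioi i.castSucc =
            Finset.cons (Fin.last n) ((Finset.Ioi i).map Fin.castSuccEmb) (by simp) := by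
          ext j
          induction j using Fin.lastCases <;> simp [Fin.castSucc_lt_last, Fin.le_last]
        rw [this, Finset.prod_cons, Finset.prod_map]
        simp
      have hw (e : Perm (Fin n)) :
          w ∘ Fin.snoc (α := fun _ => Fin (n + 1)) (p.succAbove ∘ e) p ∘ Fin.castSucc =
            (fun i => w (p.succAbove i)) ∘ e := by
        ext i
        simp
      simp only [hker, hw, Fin.snoc_last]
      rw [Fin.prod_univ_succAbove _ p]
      simp only [Finset.mul_sum, Finset.sum_mul]
      refine Finset.sum_congr rfl fun e _ => ?_
      ring

/-! ### Change of basis and homogenization -/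

open Polynomial Matrix in
/-- The polynomials `z ^ j * (1 - z) ^ (n - 1 - j)`, `j < n`, arise from the monomials `z ^ j` by a
unitriangular change of basis, which does not affect the determinant. -/
theorem det_bernstein_sub_eq_det_pow_sub {n : ℕ} (a b y : Fin n → R) :
    (of fun i j : Fin n => a i ^ (j : ℕ) * (1 - a i) ^ (n - 1 - (j : ℕ)) -
      y i * (b i ^ (j : ℕ) * (1 - b i) ^ (n - 1 - (j : ℕ)))).det =
    (of fun i j : Fin n => a i ^ (j : ℕ) - y i * b i ^ (j : ℕ)).det := by
  let p (j : ℕ) : R[X] := X ^ j * (1 - X) ^ (n - 1 - j)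
  have hev (z : R) (j : Fin n) :
      z ^ (j : ℕ) * (1 - z) ^ (n - 1 - (j : ℕ)) = ∑ k : Fin n, z ^ (k : ℕ) * (p j).coeff k := by
    have hd : (p j).natDegree < n := by
      have h1 : ((1 : R[X]) - X).natDegree ≤ 1 :=
        (natDegree_sub_le _ _).trans (by simp [natDegree_X_le])
      have h2 := natDegree_mul_le (p := (X : R[X]) ^ (j : ℕ)) (q := (1 - X) ^ (n - 1 - (j : ℕ)))
      have h3 := natDegree_X_pow_le (R := R) (j : ℕ)
      have h4 := natDegree_pow_le_of_le (n - 1 - (j : ℕ)) h1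
      have := j.2
      change (X ^ (j : ℕ) * (1 - X) ^ (n - 1 - (j : ℕ)) : R[X]).natDegree < n
      omega
    have : (p j).eval z = z ^ (j : ℕ) * (1 - z) ^ (n - 1 - (j : ℕ)) := by simp [p]
    rw [← this, eval_eq_sum_range' hd, Finset.sum_range]
    exact Finset.sum_congr rfl fun k _ => mul_comm _ _
  have hmul : (of fun i j : Fin n => a i ^ (j : ℕ) * (1 - a i) ^ (n - 1 - (j : ℕ)) -
      y i * (b i ^ (j : ℕ) * (1 - b i) ^ (n - 1 - (j : ℕ)))) =
      (of fun i j : Fin n => a i ^ (j : ℕ) - y i * b i ^ (j : ℕ)) *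
        of fun k j : Fin n => (p j).coeff k := by
    ext i j
    simp only [of_apply, mul_apply]
    rw [hev, hev, Finset.mul_sum, ← Finset.sum_sub_distrib]
    exact Finset.sum_congr rfl fun k _ => by ring
  have htri : (of fun k j : Fin n => (p j).coeff k).det = 1 := by
    rw [det_of_isLowerTriangular]
    · refine Finset.prod_eq_one fun j _ => ?_
      simp [p, coeff_X_pow_mul', coeff_zero_eq_eval_zero]
    · intro k j hkj
      have : ¬ (j : ℕ) ≤ k := not_le.2 hkj
      simp only [p, of_apply, coeff_X_pow_mul', if_neg this]
  rw [hmul, det_mul, htri, mul_one]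

theorem prod_prod_Ioi_mul {n : ℕ} (x : Fin n → R) :
    ∏ i, ∏ j ∈ Finset.Ioi i, (x i * x j) = ∏ i, x i ^ (n - 1) := by
  have h : ∏ i, ∏ j ∈ Finset.Ioi i, x j = ∏ j, ∏ i ∈ Finset.Iio j, x j :=
    Finset.prod_comm' (by simp)
  simp only [Finset.prod_mul_distrib]
  rw [h, ← Finset.prod_mul_distrib]
  refine Finset.prod_congr rfl fun i _ => ?_
  rw [Finset.prod_const, Finset.prod_const, Fin.card_Ioi, Fin.card_Iio, ← pow_add]
  congr 1
  omega

/-- The left-hand side of the core identity for `b = g / e`, multiplied by `∏ i, e i ^ (n - 1)`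
to clear the denominators. -/
def altSide (M n : ℕ) (e g w : Fin n → R) : R :=
  (∑ σ : Perm (Fin n), ((Perm.sign σ : ℤ) : R) *
    ((∏ i, ∏ j ∈ Finset.Ioi i, (e (σ i) * g (σ j) - e (σ j) * (w (σ i) * g (σ i)))) *
      strictSum M n (w ∘ σ))) * ∏ i, (1 - w i)

/-- The determinant in the core identity for `b = g / e`, multiplied by `∏ i, e i ^ (n - 1)` to
clear the denominators, and with the monomials `z ^ j` replaced by `z ^ j * (1 - z) ^ (n - 1 - j)`
as in `det_bernstein_sub_eq_det_pow_sub`. -/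
def detSide (M n : ℕ) (e g w : Fin n → R) : R :=
  (Matrix.of fun i j : Fin n =>
    (w i * g i) ^ (j : ℕ) * (e i - w i * g i) ^ (n - 1 - (j : ℕ)) -
      w i ^ M * (g i ^ (j : ℕ) * (e i - g i) ^ (n - 1 - (j : ℕ)))).det

theorem map_altSide {S : Type*} [CommRing S] (f : R →+* S) (M n : ℕ) (e g w : Fin n → R) :
    f (altSide M n e g w) = altSide M n (f ∘ e) (f ∘ g) (f ∘ w) := by
  simp [altSide, strictSum]

theorem map_detSide {S : Type*} [CommRing S] (f : R →+* S) (M n : ℕ) (e g w : Fin n → R) :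
    f (detSide M n e g w) = detSide M n (f ∘ e) (f ∘ g) (f ∘ w) := by
  rw [detSide, RingHom.map_det]
  congr 1
  ext i j
  simp

theorem altSide_eq_detSide_mul (M n : ℕ) (e b w : Fin n → R) :
    altSide M n e (e * b) w = detSide M n e (e * b) w := by
  have hdet : detSide M n e (e * b) w = (∏ i, e i ^ (n - 1)) *
      (Matrix.of fun i j : Fin n =>
        (w i * b i) ^ (j : ℕ) * (1 - w i * b i) ^ (n - 1 - (j : ℕ)) -
        w i ^ M * (b i ^ (j : ℕ) * (1 - b i) ^ (n - 1 - (j : ℕ)))).det := by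
    rw [← Matrix.det_mul_column, detSide]
    congr 1
    ext i j
    have hj : n - 1 = (j : ℕ) + (n - 1 - j) := by have := j.2; omega
    simp only [Matrix.of_apply, Pi.mul_apply]
    rw [show e i - w i * (e i * b i) = e i * (1 - w i * b i) by ring,
      show e i - e i * b i = e i * (1 - b i) by ring]
    simp only [mul_pow]
    generalize n - 1 - (j : ℕ) = k at hj
    rw [hj, pow_add]
    ring
  have hcore := alternating_sum_mul_prod_eq_det M n b w
  rw [hdet, det_bernstein_sub_eq_det_pow_sub]
  have : (Matrix.of fun i j : Fin n => (w i * b i) ^ (j : ℕ) - w i ^ M * b i ^ (j : ℕ)) =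
      Matrix.of fun i j : Fin n => b i ^ (j : ℕ) * (w i ^ (j : ℕ) - w i ^ M) := by
    ext i j
    simp only [Matrix.of_apply]
    ring
  rw [this, ← hcore, altSide, ← mul_assoc, Finset.mul_sum]
  congr 1
  refine Finset.sum_congr rfl fun σ _ => ?_
  have hker : ∏ i, ∏ j ∈ Finset.Ioi i, (e (σ i) * (e * b) (σ j) -
      e (σ j) * (w (σ i) * (e * b) (σ i))) = (∏ i, e i ^ (n - 1)) *
        ∏ i, ∏ j ∈ Finset.Ioi i, (b (σ j) - w (σ i) * b (σ i)) := by
    rw [← Equiv.prod_comp σ fun i => e i ^ (n - 1), ← prod_prod_Ioi_mul fun i => e (σ i)]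
    simp only [← Finset.prod_mul_distrib, Pi.mul_apply]
    exact Finset.prod_congr rfl fun i _ => Finset.prod_congr rfl fun j _ => by ring
  rw [hker]
  ring

end CommRing

open Polynomial in
theorem altSide_eq_detSide {K : Type*} [Field K] (M n : ℕ) (e g w : Fin n → K) :
    altSide M n e g w = detSide M n e g w := by
  -- Perturb `e` to `e + t`, which is invertible in the fraction field of `K[t]`.
  let ι : K[X] →+* FractionRing K[X] := algebraMap _ _
  have hι : Function.Injective ι := IsFractionRing.injective _ _
  have hpoly : altSide M n (fun i => C (e i) + X) (fun i => C (g i)) (fun i => C (w i)) =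
      detSide M n (fun i => C (e i) + X) (fun i => C (g i)) (fun i => C (w i)) := by
    apply hι
    rw [map_altSide, map_detSide]
    have hne (i : Fin n) : ι (C (e i) + X) ≠ 0 := by
      rw [Ne, map_eq_zero_iff ι hι, add_comm]
      exact X_add_C_ne_zero _
    have := altSide_eq_detSide_mul M n (ι ∘ fun i => C (e i) + X)
      (fun i => ι (C (g i)) / ι (C (e i) + X)) (ι ∘ fun i => C (w i))
    have hg : (ι ∘ fun i => C (e i) + X) * (fun i => ι (C (g i)) / ι (C (e i) + X)) =
        ι ∘ fun i => C (g i) := by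
      ext i
      exact mul_div_cancel₀ _ (hne i)
    rwa [hg] at this
  have := congrArg (evalRingHom (0 : K)) hpoly
  rw [map_altSide, map_detSide] at this
  simpa [Function.comp_def] using this

/-! ### Specialization to the variables of the theorem -/

section Field

variable {K : Type*} [Field K]

theorem boundedSum_eq_strictSum {n : ℕ} (m : ℕ) (Q : K) (X : Fin n → K) :
    boundedSum m Q X = strictSum (m + 1) n fun i => X i * (1 + X i) / (Q + X i) := by
  unfold boundedSum strictSum
  refine Finset.sum_nbij' (fun k i => (k i : ℕ)) (fun k i => Fin.ofNat (m + 1) (k i))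
    ?_ ?_ ?_ ?_ ?_
  · intro k hk
    simp only [Finset.mem_filter, Finset.mem_univ, true_and, Fintype.mem_piFinset,
      Finset.mem_range] at hk ⊢
    exact ⟨fun i => (k i).2, fun i j hij => hk i j hij⟩
  · intro k hk
    simp only [Finset.mem_filter, Finset.mem_univ, true_and, Fintype.mem_piFinset,
      Finset.mem_range] at hk ⊢
    intro i j hij
    rw [Fin.lt_def, Fin.val_ofNat, Fin.val_ofNat, Nat.mod_eq_of_lt (hk.1 i),
      Nat.mod_eq_of_lt (hk.1 j)]
    exact hk.2 hij
  · intro k _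
    ext i
    simp
  · intro k hk
    simp only [Finset.mem_filter, Fintype.mem_piFinset, Finset.mem_range] at hk
    ext i
    exact Nat.mod_eq_of_lt (hk.1 i)
  · intro k _
    rfl

/-- Multiplying `f` by the Vandermonde factors, which do not vanish, reduces the claim to the
corresponding statement for antisymmetric functions. -/
theorem prod_Ioi_comp_perm_of_symm {n : ℕ} {X : Fin n → K} (hX : ∀ i j, i < j → X j - X i ≠ 0)
    {f : Fin n → Fin n → K} (hf : ∀ i j, f i j = f j i) (σ : Perm (Fin n)) :
    ∏ i, ∏ j ∈ Finset.Ioi i, f (σ i) (σ j) = ∏ i, ∏ j ∈ Finset.Ioi i, f i j := by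
  have h1 := σ.prod_Ioi_comp_eq_sign_mul_prod (f := fun i j => X j - X i) fun i j => by ring
  have h2 := σ.prod_Ioi_comp_eq_sign_mul_prod (f := fun i j => (X j - X i) * f i j)
    fun i j => by rw [hf i j]; ring
  simp only [Finset.prod_mul_distrib] at h2
  have hV : ((Perm.sign σ : ℤ) : K) * ∏ i, ∏ j ∈ Finset.Ioi i, (X j - X i) ≠ 0 := by
    refine mul_ne_zero ?_ (Finset.prod_ne_zero_iff.2 fun i _ => Finset.prod_ne_zero_iff.2
      fun j hj => hX i j (Finset.mem_Ioi.1 hj))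
    rcases Int.units_eq_one_or (Perm.sign σ) with h | h <;> simp [h]
  rw [h1, ← mul_assoc] at h2
  exact mul_left_cancel₀ hV h2

/-- The entries in terms of `u = x (1 + x)`, `v = Q + (Q + r) x` and `g = Q + x`,
`h = x (x + Q + r)`. Up to powers of `x` and `Q`, the substitution `x ↦ Q / x` exchanges `(u, v)`
and `(g, h)`. -/
theorem aEntry_succ {j n : ℕ} (hj : j < n) (m : ℕ) {Q x : K} (r : K) (hQ : Q ≠ 0) (hx : x ≠ 0)
    (hQx : Q + x ≠ 0) :
    aEntry (j + 1) m n Q r x = (Q + x) *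
      ((x * (1 + x)) ^ j * (Q + (Q + r) * x) ^ (n - 1 - j) -
        (x * (1 + x) / (Q + x)) ^ (m + 1) *
          ((Q + x) ^ j * (x * (x + (Q + r))) ^ (n - 1 - j))) := by
  obtain ⟨k, rfl⟩ : ∃ k, n = j + 1 + k := ⟨n - (j + 1), by omega⟩
  rw [show j + 1 + k - 1 - j = k by omega]
  unfold aEntry
  rw [show j + 1 + k - (j + 1) = k by omega, show j + 1 - 1 = j by omega,
    show 1 + Q * x⁻¹ = (Q + x) * x⁻¹ by field_simp; ring,
    show Q + r * Q * x⁻¹ + Q ^ 2 * x⁻¹ = Q * x⁻¹ * (x + (Q + r)) by field_simp; ring,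
    show Q + r * x + Q * x = Q + (Q + r) * x by ring,
    show (1 + x) * x / (Q + x) = x * (1 + x) / (Q + x) by ring,
    pow_succ (x * (1 + x) / (Q + x)) m]
  generalize (x * (1 + x) / (Q + x)) ^ m = z
  simp only [mul_pow, inv_pow, pow_add, pow_mul, pow_one]
  field_simp
  ring

end Field

open Matrix in
theorem theorem1 {K : Type*} [Field K] (n m : ℕ) (hn : 1 ≤ n) (Q r : K) (X : Fin n → K)
    (hQ : Q ≠ 0) (hX : ∀ i, X i ≠ 0) (hQX : ∀ i, Q + X i ≠ 0)
    (hQXX : ∀ i j, i ≤ j → Q - X i * X j ≠ 0) (hinj : ∀ i j, i < j → X j - X i ≠ 0) :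
    1 / vandermondeProd X * ASym (fun Y => kernelProd Q r Y * boundedSum m Q Y) X
      = (Matrix.of (fun i j : Fin n => aEntry ((j : ℕ) + 1) m n Q r (X i))).det
        / ((∏ i, ∏ j ∈ Finset.Ici i, (Q - X i * X j)) * vandermondeProd X) := by
  have hV : vandermondeProd X ≠ 0 := Finset.prod_ne_zero_iff.2 fun i _ =>
    Finset.prod_ne_zero_iff.2 fun j hj => hinj i j (Finset.mem_Ioi.1 hj)
  have hD : (∏ i, ∏ j ∈ Finset.Ici i, (Q - X i * X j)) ≠ 0 := Finset.prod_ne_zero_iff.2 fun i _ =>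
    Finset.prod_ne_zero_iff.2 fun j hj => hQXX i j (Finset.mem_Ici.1 hj)
  suffices h : ASym (fun Y => kernelProd Q r Y * boundedSum m Q Y) X *
      (∏ i, ∏ j ∈ Finset.Ici i, (Q - X i * X j)) =
      (Matrix.of (fun i j : Fin n => aEntry ((j : ℕ) + 1) m n Q r (X i))).det by
    rw [← h]
    field_simp
  set e : Fin n → K := fun i => Q + X i + X i * (X i + (Q + r)) with he
  set g : Fin n → K := fun i => Q + X i with hg
  set w : Fin n → K := fun i => X i * (1 + X i) / (Q + X i) with hw
  have hwg (i : Fin n) : w i * g i = X i * (1 + X i) := div_mul_cancel₀ _ (hQX i)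
  have hdet : (Matrix.of (fun i j : Fin n => aEntry ((j : ℕ) + 1) m n Q r (X i))).det =
      (∏ i, g i) * detSide (m + 1) n e g w := by
    rw [detSide, ← det_mul_column]
    congr 1
    ext i j
    simp only [of_apply]
    rw [aEntry_succ j.2 m r hQ (hX i) (hQX i), hwg,
      show e i - X i * (1 + X i) = Q + (Q + r) * X i by rw [he]; ring,
      show e i - g i = X i * (X i + (Q + r)) by rw [he, hg]; ring]
  have hden : (∏ i, ∏ j ∈ Finset.Ici i, (Q - X i * X j)) =
      (∏ i, ∏ j ∈ Finset.Ioi i, (Q - X i * X j)) * ((∏ i, g i) * ∏ i, (1 - w i)) := by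
    rw [← Finset.prod_mul_distrib, ← Finset.prod_mul_distrib]
    refine Finset.prod_congr rfl fun i _ => ?_
    rw [← Finset.Ioi_insert, Finset.prod_insert (by simp), mul_comm]
    congr 1
    linear_combination hwg i
  -- The factors `Q - X i * X j` with `i < j` form a symmetric function, which can be moved into the
  -- antisymmetrizer, where they complete the kernel to that of `altSide`.
  suffices h : ASym (fun Y => kernelProd Q r Y * boundedSum m Q Y) X *
      ∏ i, ∏ j ∈ Finset.Ioi i, (Q - X i * X j) =
      ∑ σ : Perm (Fin n), ((Perm.sign σ : ℤ) : K) *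
        ((∏ i, ∏ j ∈ Finset.Ioi i, (e (σ i) * g (σ j) - e (σ j) * (w (σ i) * g (σ i)))) *
          strictSum (m + 1) n (w ∘ σ)) by
    rw [hdet, hden, ← altSide_eq_detSide, altSide, ← h]
    ring
  rw [ASym, Finset.sum_mul]
  refine Finset.sum_congr rfl fun σ _ => ?_
  have hker : kernelProd Q r (fun i => X (σ i)) * ∏ i, ∏ j ∈ Finset.Ioi i, (Q - X i * X j) =
      ∏ i, ∏ j ∈ Finset.Ioi i, (e (σ i) * g (σ j) - e (σ j) * (w (σ i) * g (σ i))) := by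
    rw [kernelProd, ← prod_Ioi_comp_perm_of_symm hinj (f := fun i j => Q - X i * X j)
      (fun i j => by rw [mul_comm]) σ]
    simp only [← Finset.prod_mul_distrib]
    refine Finset.prod_congr rfl fun i _ => Finset.prod_congr rfl fun j _ => ?_
    rw [hwg, he, hg]
    ring
  rw [← hker, boundedSum_eq_strictSum]
  change _ = _ * (_ * strictSum (m + 1) n fun i => X (σ i) * (1 + X (σ i)) / (Q + X (σ i)))
  ring
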